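/- \textbf{Lemma.} There is an absolute constant $C>0$ such that for every $\varepsilon\in(0,1/2)$ there exist a real number $K$ with $0<K\le C/\varepsilon^3$ and an integer $n_0$ (both depending only on $\varepsilon$) such that the following holds. Let $G=(V,E)$ be a finite simple graph with $n\ge n_0$ vertices. For a non-empty set $S\subseteq V$ let $e(S,V\setminus S)$ be the number of edges with exactly one endpoint in $S$, and let \[ h(G)=\min\left\{\frac{e(S,V\setminus S)}{|S|} : \emptyset\ne S\subseteq V,\ |S|\le n/2\right\} \] be the Cheeger constant of $G$. Let $d>0$ be a real number such that $G$ has maximum degree at most $d$ and $h(G)\ge\varepsilon d$. Let $s$ be a real number and $q\le n$ a natural number with $sq\ge 2n$, and let $U_1,\dots,U_q\subseteq V$ be sets of vertices with $|U_i|\ge s$ for every $i$. Then there is a set $T\subseteq V$ which induces a connected subgraph of $G$, has size \[ |T|\le K\cdot\frac{n}{s}\,\log\left(\frac{qs}{n}\right) \] (where $\log$ is the natural logarithm), and satisfies $T\cap U_i\neq\emptyset$ for every $i$. -/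

import Mathlib

open Finset

namespace SimpleGraph

variable {V : Type*} [Fintype V] [DecidableEq V] (G : SimpleGraph V) [DecidableRel G.Adj]

/-- The edge expansion `h(S) = e(S, V \ S) / |S|` of a set `S` of vertices. The ordered pairs in
`G.interedges S Sᶜ` correspond bijectively to the edges across the cut, as `S` and `Sᶜ` are
disjoint. -/
noncomputable def edgeExpansion (S : Finset V) : ℝ :=
  (#(G.interedges S Sᶜ) : ℝ) / (#S : ℝ)

/-- The Cheeger constant `h(G) = min {h(S) : ∅ ≠ S ⊆ V, |S| ≤ n / 2}`, where `n = |V|`. The infimum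
is over a finite set, so it is a minimum when `n ≥ 2`; for `n ≤ 1` the set is empty and the value
is `0`. -/
noncomputable def cheegerConstant : ℝ :=
  sInf (G.edgeExpansion '' {S : Finset V | S.Nonempty ∧ (#S : ℝ) ≤ (Fintype.card V : ℝ) / 2})

end SimpleGraph

/-!
The set `T` is the vertex set of a lazy random walk of length `L` of order
`ε⁻² * (n / s) * log (q * s / n)` together with shortest paths from it to all the sets `U i`.

Edge expansion gives a Poincaré inequality with constant of order `ε²` (Cheeger, `poincare_of_cut`),
so averaging along the walk contracts functions supported off a set of density `w` by a factor
`1 - ε² w / 4` in the square of the `ℓ²` norm. Hence a walk with uniform start misses that set with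
probability at most `(1 - w) * exp (-(ε² L / 8) * w)` (`sum_stayProb_le`).

The distance from the walk to `U i` is the number of radii `r` such that the walk misses the
`r`-neighbourhood of `U i`. These neighbourhoods grow by a factor `1 + ε` until they fill half of
the graph, after which their complements shrink by a factor `1 - ε`
(`SimpleGraph.min_card_le_card_neighborhoodIter_sub`). Summing the probabilities of missing them
(`sum_one_sub_mul_exp_le`) bounds the expected distance by
`(4 / ε) * exp (-(ε² L / 8) * (s / n)) ≤ (4 / ε) * n / (q * s)`.
So the `q` paths cost `(4 / ε) * n / s` vertices in total, which is dominated by the desired bound.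

No probability space is needed: the probabilities of staying in a set are defined by recursion on
the length of the walk (`stayProb`), and a walk no worse than average is found by the method of
conditional expectations (`exists_connected_sum_le_sum_stayProb`). The argument applies to every
non-empty graph and gives `K = 20 / ε²`.
-/

/-! ### Edge weights of a graph -/

section Weight

variable {V : Type*}

/-- The weight function of a graph: `1` on adjacent pairs and `0` elsewhere. -/
noncomputable def SimpleGraph.adjWeight (G : SimpleGraph V) [DecidableRel G.Adj] (u v : V) : ℝ :=
  if G.Adj u v then 1 else 0

theorem SimpleGraph.adjWeight_comm (G : SimpleGraph V) [DecidableRel G.Adj] (u v : V) :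
    G.adjWeight u v = G.adjWeight v u := by
  simp [adjWeight, G.adj_comm]

theorem SimpleGraph.adjWeight_nonneg (G : SimpleGraph V) [DecidableRel G.Adj] (u v : V) :
    0 ≤ G.adjWeight u v := by
  rw [adjWeight]; split_ifs <;> simp

theorem SimpleGraph.sum_adjWeight [Fintype V] (G : SimpleGraph V) [DecidableRel G.Adj] (u : V) :
    ∑ v, G.adjWeight u v = G.degree u := by
  simp [adjWeight, ← card_neighborFinset_eq_degree, neighborFinset_eq_filter]

theorem SimpleGraph.sum_adjWeight_eq_card_interedges (G : SimpleGraph V)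
    [DecidableRel G.Adj] (S T : Finset V) :
    ∑ u ∈ S, ∑ v ∈ T, G.adjWeight u v = #(G.interedges S T) := by
  rw [interedges_def, card_filter, sum_product]
  push_cast
  rfl

end Weight

/-! ### Cheeger's inequality -/

section Expansion

variable {V : Type*} [Fintype V] [DecidableEq V]

theorem exists_median (f : V → ℝ) [Nonempty V] : ∃ m : ℝ,
    (#{v | m < f v} : ℝ) ≤ (Fintype.card V : ℝ) / 2 ∧
    (#{v | f v < m} : ℝ) ≤ (Fintype.card V : ℝ) / 2 := by
  -- The median is the least value exceeded on at most half of the vertices.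
  set A : Finset V := {x | (#{v | f x < f v} : ℝ) ≤ (Fintype.card V : ℝ) / 2} with hA
  obtain ⟨y, hy⟩ := Finite.exists_max f
  have hyA : y ∈ A := by
    simp only [hA, mem_filter, mem_univ, true_and]
    rw [filter_false_of_mem fun v _ => not_lt.2 (hy v)]
    simp; positivity
  obtain ⟨x, hx, hmin⟩ := A.exists_min_image f ⟨y, hyA⟩
  refine ⟨f x, by simpa [hA] using hx, ?_⟩
  rcases ({v | f v < f x} : Finset V).eq_empty_or_nonempty with h | h
  · rw [h]; simp; positivity
  · obtain ⟨z, hz, hmax⟩ := exists_max_image _ f h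
    have hzA : z ∉ A := fun hzA => absurd (hmin z hzA) (not_le.2 (by simpa using hz))
    simp only [hA, mem_filter, mem_univ, true_and, not_le] at hzA
    have hdisj : #{v | f z < f v} + #{v | f v < f x} ≤ Fintype.card V := by
      rw [← card_union_of_disjoint]
      · exact card_le_univ _
      · rw [Finset.disjoint_left]
        intro v h1 h2
        exact absurd (hmax v h2) (not_le.2 (by simpa using h1))
    have : (#{v | f z < f v} : ℝ) + #{v | f v < f x} ≤ Fintype.card V := by exact_mod_cast hdisj
    linarith

/-- The discrete co-area inequality. Subtracting from `F` its least positive value on the support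
`S` lowers the right-hand side by twice that value times the weight of the cut of `S`; induction
on the size of the support does the rest. The factor `2` is there because every edge is counted in
both orientations. -/
theorem sum_le_sum_abs_sub_of_cut (a : V → V → ℝ) (ha : ∀ u v, a u v = a v u)
    (c : ℝ)
    (hcut : ∀ S : Finset V, (#S : ℝ) ≤ (Fintype.card V : ℝ) / 2 →
      c * #S ≤ ∑ u ∈ S, ∑ v ∈ Sᶜ, a u v)
    (F : V → ℝ) (hF : ∀ v, 0 ≤ F v)
    (hsupp : (#{v | 0 < F v} : ℝ) ≤ (Fintype.card V : ℝ) / 2) :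
    2 * c * ∑ v, F v ≤ ∑ u, ∑ v, a u v * |F u - F v| := by
  induction hk : #{v | 0 < F v} using Nat.strong_induction_on generalizing F with
  | _ k ih =>
  set S : Finset V := {v | 0 < F v} with hS
  have hmem : ∀ v, v ∈ S ↔ 0 < F v := fun v => by simp [hS]
  have hout : ∀ v, v ∉ S → F v = 0 := fun v hv =>
    le_antisymm (not_lt.1 fun h => hv ((hmem v).2 h)) (hF v)
  rcases S.eq_empty_or_nonempty with h0 | hne
  · have hz : ∀ v, F v = 0 := fun v => hout v (by simp [h0])
    simp [hz]
  · obtain ⟨x, hx, hmin⟩ := S.exists_min_image F hne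
    -- Peel off the lowest layer, so that `F' x = 0` and the support shrinks.
    set F' : V → ℝ := fun v => if v ∈ S then F v - F x else 0 with hF'
    have hF'0 : ∀ v, 0 ≤ F' v := fun v => by
      by_cases hv : v ∈ S
      · simpa [hF', hv] using hmin v hv
      · simp [hF', hv]
    have hsub : ({v | 0 < F' v} : Finset V) ⊂ S := by
      refine (ssubset_iff_of_subset fun v hv => ?_).2 ⟨x, hx, by simp [hF', hx]⟩
      by_contra hvS
      simp [hF', hvS] at hv
    have hlt := card_lt_card hsub
    have key := ih _ (hk ▸ hlt) F' hF'0
      (le_trans (by exact_mod_cast hlt.le) hsupp) rfl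
    have hsum : ∑ v, F v = ∑ v, F' v + F x * #S := by
      have : ∀ v, F v = F' v + if v ∈ S then F x else 0 := fun v => by
        by_cases hv : v ∈ S
        · simp [hF', hv]
        · simp [hF', hv, hout v hv]
      rw [sum_congr rfl fun v _ => this v, sum_add_distrib]
      simp [mul_comm]
    have hpt : ∀ u v, a u v * |F u - F v| = a u v * |F' u - F' v|
        + (F x * (if u ∈ S then (if v ∈ Sᶜ then a u v else 0) else 0)
          + F x * (if v ∈ S then (if u ∈ Sᶜ then a v u else 0) else 0)) := fun u v => by
      by_cases hu : u ∈ S <;> by_cases hv : v ∈ S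
      · simp [hF', hu, hv]
      · have := hF'0 u
        have h1 : F u = F' u + F x := by simp [hF', hu]
        simp only [hu, hv, hout v hv, mem_compl, not_false_eq_true, if_true, if_false, h1,
          sub_zero, show F' v = 0 by simp [hF', hv]]
        rw [abs_of_nonneg this, abs_of_nonneg (add_nonneg this (hF x))]; ring
      · have := hF'0 v
        have h1 : F v = F' v + F x := by simp [hF', hv]
        simp only [hu, hv, hout u hu, mem_compl, not_false_eq_true, if_true, if_false, h1,
          zero_sub, abs_neg, show F' u = 0 by simp [hF', hu]]
        rw [abs_of_nonneg this, abs_of_nonneg (add_nonneg this (hF x)), ha v u]; ring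
      · simp [hF', hu, hv, hout]
    have hcutsum : ∑ u, ∑ v, (if u ∈ S then (if v ∈ Sᶜ then a u v else 0) else 0)
        = ∑ u ∈ S, ∑ v ∈ Sᶜ, a u v := by
      rw [← sum_filter_add_sum_filter_not univ (· ∈ S)]
      rw [sum_congr (s₁ := univ.filter (· ∉ S)) rfl (g := fun _ => 0)]
      · rw [sum_const_zero, add_zero, filter_univ_mem]
        refine sum_congr rfl fun u hu => ?_
        simp only [hu, if_true]
        rw [← sum_filter, filter_univ_mem]
      · intro u hu
        simp [(mem_filter.1 hu).2]
    have htot : ∑ u, ∑ v, a u v * |F u - F v| = ∑ u, ∑ v, a u v * |F' u - F' v|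
        + 2 * (F x * ∑ u ∈ S, ∑ v ∈ Sᶜ, a u v) := by
      simp_rw [hpt, sum_add_distrib, ← mul_sum]
      rw [hcutsum, sum_comm (f := fun u v => if v ∈ S then (if u ∈ Sᶜ then a v u else 0) else 0),
        hcutsum]
      ring
    rw [hsum, htot]
    nlinarith [mul_le_mul_of_nonneg_left (hcut S hsupp) (hF x)]

/-- Cheeger's inequality for non-negative functions supported on at most half of the vertices: the
co-area inequality for `g ^ 2`, with `|g u ^ 2 - g v ^ 2| = |g u - g v| * (g u + g v)` split by
Cauchy–Schwarz. -/
theorem sum_sq_le_of_cut_of_nonneg (a : V → V → ℝ) (ha : ∀ u v, a u v = a v u)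
    (ha0 : ∀ u v, 0 ≤ a u v) {d ε : ℝ} (hd : 0 < d) (hdeg : ∀ u, ∑ v, a u v ≤ d) (hε : 0 ≤ ε)
    (hcut : ∀ S : Finset V, (#S : ℝ) ≤ (Fintype.card V : ℝ) / 2 →
      ε * d * #S ≤ ∑ u ∈ S, ∑ v ∈ Sᶜ, a u v)
    (g : V → ℝ) (hg : ∀ v, 0 ≤ g v)
    (hsupp : (#{v | 0 < g v} : ℝ) ≤ (Fintype.card V : ℝ) / 2) :
    ε ^ 2 * d * ∑ v, g v ^ 2 ≤ ∑ u, ∑ v, a u v * (g u - g v) ^ 2 := by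
  set N := ∑ v, g v ^ 2 with hN
  set D := ∑ u, ∑ v, a u v * (g u - g v) ^ 2 with hD
  have hN0 : 0 ≤ N := sum_nonneg fun _ _ => sq_nonneg _
  have hD0 : 0 ≤ D := sum_nonneg fun _ _ => sum_nonneg fun _ _ =>
    mul_nonneg (ha0 _ _) (sq_nonneg _)
  have h1 := sum_le_sum_abs_sub_of_cut a ha (ε * d) hcut (fun v => g v ^ 2)
    (fun v => sq_nonneg _) (by
      convert hsupp using 4 with v
      exact ⟨fun h => (hg v).lt_of_ne' fun h0 => by simp [h0] at h, fun h => by positivity⟩)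
  have hCS : (∑ u, ∑ v, a u v * |g u ^ 2 - g v ^ 2|) ^ 2
      ≤ D * ∑ u, ∑ v, a u v * (g u + g v) ^ 2 := by
    rw [hD]
    simp_rw [← sum_product']
    refine sum_sq_le_sum_mul_sum_of_sq_le_mul _ (fun p _ => mul_nonneg (ha0 _ _) (sq_nonneg _))
      (fun p _ => mul_nonneg (ha0 _ _) (sq_nonneg _)) fun p _ => ?_
    rw [mul_pow, sq_abs]
    exact le_of_eq (by ring)
  have hdeg2 : ∑ u, ∑ v, a u v * g u ^ 2 ≤ d * N := by
    rw [hN, mul_sum]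
    refine sum_le_sum fun u _ => ?_
    rw [← sum_mul]
    exact mul_le_mul_of_nonneg_right (hdeg u) (sq_nonneg _)
  have hplus : ∑ u, ∑ v, a u v * (g u + g v) ^ 2 ≤ 4 * d * N := by
    have h2 : ∑ u, ∑ v, a u v * g v ^ 2 = ∑ u, ∑ v, a u v * g u ^ 2 := by
      rw [sum_comm]
      exact sum_congr rfl fun u _ => sum_congr rfl fun v _ => by rw [ha]
    have h3 : ∑ u, ∑ v, a u v * (g u + g v) ^ 2
        ≤ ∑ u, ∑ v, (2 * (a u v * g u ^ 2) + 2 * (a u v * g v ^ 2)) :=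
      sum_le_sum fun u _ => sum_le_sum fun v _ => by
        nlinarith [mul_nonneg (ha0 u v) (sq_nonneg (g u - g v))]
    simp_rw [sum_add_distrib, ← mul_sum, h2] at h3
    linarith
  rcases hN0.eq_or_lt with h0 | hpos
  · rw [← h0, mul_zero]; exact hD0
  · have h4 : (2 * (ε * d) * N) ^ 2 ≤ D * (4 * d * N) :=
      (pow_le_pow_left₀ (by positivity) h1 2).trans
        (hCS.trans (mul_le_mul_of_nonneg_left hplus hD0))
    have h5 : 0 < 4 * d * N := by positivity
    refine le_of_mul_le_mul_right ?_ h5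
    linarith [h4]

/-- The Poincaré inequality: edge expansion `ε` bounds the variance by the Dirichlet form. Both the
positive and the negative part of `f - m`, with `m` a median of `f`, are supported on at most half
of the vertices. -/
theorem poincare_of_cut (a : V → V → ℝ) (ha : ∀ u v, a u v = a v u)
    (ha0 : ∀ u v, 0 ≤ a u v) {d ε : ℝ} (hd : 0 < d) (hdeg : ∀ u, ∑ v, a u v ≤ d) (hε : 0 ≤ ε)
    (hcut : ∀ S : Finset V, (#S : ℝ) ≤ (Fintype.card V : ℝ) / 2 →
      ε * d * #S ≤ ∑ u ∈ S, ∑ v ∈ Sᶜ, a u v)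
    (f : V → ℝ) :
    ε ^ 2 * d * (∑ v, f v ^ 2 - (∑ v, f v) ^ 2 / Fintype.card V)
      ≤ ∑ u, ∑ v, a u v * (f u - f v) ^ 2 := by
  cases isEmpty_or_nonempty V
  · simp
  obtain ⟨m, hm1, hm2⟩ := exists_median f
  have hpos := sum_sq_le_of_cut_of_nonneg a ha ha0 hd hdeg hε hcut (fun v => max (f v - m) 0)
    (fun v => le_max_right _ _) (by simpa using hm1)
  have hneg := sum_sq_le_of_cut_of_nonneg a ha ha0 hd hdeg hε hcut (fun v => max (m - f v) 0)
    (fun v => le_max_right _ _) (by simpa using hm2)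
  have hsplit : ∀ x : ℝ, max (x - m) 0 ^ 2 + max (m - x) 0 ^ 2 = (x - m) ^ 2 := fun x => by
    rcases le_total x m with h | h
    · rw [max_eq_right (by linarith), max_eq_left (by linarith)]; ring
    · rw [max_eq_left (by linarith), max_eq_right (by linarith)]; ring
  have hcontr : ∀ x y : ℝ, (max (x - m) 0 - max (y - m) 0) ^ 2
      + (max (m - x) 0 - max (m - y) 0) ^ 2 ≤ (x - y) ^ 2 := fun x y => by
    rcases le_total x m with h | h <;> rcases le_total y m with h' | h'
    · rw [max_eq_right (by linarith), max_eq_right (by linarith), max_eq_left (by linarith),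
        max_eq_left (by linarith)]; nlinarith
    · rw [max_eq_right (by linarith), max_eq_left (by linarith), max_eq_left (by linarith),
        max_eq_right (by linarith)]
      nlinarith [mul_nonneg (sub_nonneg.2 h) (sub_nonneg.2 h')]
    · rw [max_eq_left (by linarith), max_eq_right (by linarith), max_eq_right (by linarith),
        max_eq_left (by linarith)]
      nlinarith [mul_nonneg (sub_nonneg.2 h) (sub_nonneg.2 h')]
    · rw [max_eq_left (by linarith), max_eq_left (by linarith), max_eq_right (by linarith),
        max_eq_right (by linarith)]; nlinarith
  have h1 : ε ^ 2 * d * ∑ v, (f v - m) ^ 2 ≤ ∑ u, ∑ v, a u v * (f u - f v) ^ 2 := by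
    have h2 : ∑ u, ∑ v, a u v * (max (f u - m) 0 - max (f v - m) 0) ^ 2
        + ∑ u, ∑ v, a u v * (max (m - f u) 0 - max (m - f v) 0) ^ 2
        ≤ ∑ u, ∑ v, a u v * (f u - f v) ^ 2 := by
      simp_rw [← sum_add_distrib, ← mul_add]
      exact sum_le_sum fun u _ => sum_le_sum fun v _ =>
        mul_le_mul_of_nonneg_left (hcontr _ _) (ha0 _ _)
    simp_rw [← hsplit, sum_add_distrib]
    linarith
  refine le_trans (mul_le_mul_of_nonneg_left ?_ (by positivity)) h1
  have hn : (0 : ℝ) < Fintype.card V := by exact_mod_cast Fintype.card_pos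
  have h3 : ∑ v, (f v - m) ^ 2 = ∑ v, f v ^ 2 - 2 * m * ∑ v, f v + Fintype.card V * m ^ 2 := by
    simp_rw [sub_sq, sum_add_distrib, sum_sub_distrib, mul_sum]
    simp
    exact sum_congr rfl fun v _ => by ring
  rw [h3]
  -- The mean minimises the mean square deviation.
  have h4 : 0 ≤ ((∑ v, f v) - Fintype.card V * m) ^ 2 / Fintype.card V := by positivity
  have h5 : ((∑ v, f v) - Fintype.card V * m) ^ 2 / Fintype.card V
      = (∑ v, f v) ^ 2 / Fintype.card V - 2 * m * ∑ v, f v + Fintype.card V * m ^ 2 := by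
    field_simp
    ring
  linarith

end Expansion

/-! ### The lazy random walk -/

section LazyWalk

variable {V : Type*} [Fintype V]

/-- The averaging operator of the lazy random walk with edge weights `a`: from `u` the walk moves to
`v` with probability `a u v / (2 * d)` and otherwise stays at `u`. When all weighted degrees are at
most `d`, it is symmetric, so the uniform distribution is stationary, and it stays with probability
at least `1 / 2`. -/
noncomputable def lazyStep (a : V → V → ℝ) (d : ℝ) (f : V → ℝ) (u : V) : ℝ :=
  f u - (∑ v, a u v * (f u - f v)) / (2 * d)

theorem lazyStep_sum {ι : Type*} (a : V → V → ℝ) (d : ℝ) (J : Finset ι) (f : ι → V → ℝ) (u : V) :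
    lazyStep a d (fun v => ∑ j ∈ J, f j v) u = ∑ j ∈ J, lazyStep a d (f j) u := by
  simp only [lazyStep, sum_sub_distrib]
  congr 1
  rw [← sum_div, sum_comm]
  congr 1
  refine sum_congr rfl fun v _ => ?_
  rw [← sum_sub_distrib, mul_sum]

/-- Some possible next position of the walk has a value at most the average. -/
theorem exists_le_lazyStep (a : V → V → ℝ) (ha0 : ∀ u v, 0 ≤ a u v) {d : ℝ} (hd : 0 < d)
    (hdeg : ∀ u, ∑ v, a u v ≤ d) (f : V → ℝ) (u : V) :
    ∃ v, (v = u ∨ 0 < a u v) ∧ f v ≤ lazyStep a d f u := by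
  by_contra! h
  set t := lazyStep a d f u with ht
  have h1 : t < f u := h u (Or.inl rfl)
  have h2 : ∑ v, a u v * (f u - f v) ≤ ∑ v, a u v * (f u - t) :=
    sum_le_sum fun v _ => by
      rcases (ha0 u v).eq_or_lt with h0 | h0
      · simp [← h0]
      · exact mul_le_mul_of_nonneg_left (by linarith [h v (Or.inr h0)]) h0.le
  rw [← sum_mul] at h2
  have h3 : (∑ v, a u v * (f u - f v)) / (2 * d) ≤ (f u - t) / 2 := by
    rw [div_le_iff₀ (by positivity)]
    nlinarith [mul_le_mul_of_nonneg_right (hdeg u) (sub_nonneg.2 h1.le)]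
  have h4 : t = f u - (∑ v, a u v * (f u - f v)) / (2 * d) := ht
  linarith

/-- Laziness makes the averaging operator `P` positive semidefinite with `P ^ 2 ≤ P`; in elementary
terms, the square of the Laplacian is controlled by the Dirichlet form through Cauchy–Schwarz. -/
theorem sum_sq_lazyStep_le (a : V → V → ℝ) (ha : ∀ u v, a u v = a v u)
    (ha0 : ∀ u v, 0 ≤ a u v) {d : ℝ} (hd : 0 < d) (hdeg : ∀ u, ∑ v, a u v ≤ d) (f : V → ℝ) :
    ∑ u, lazyStep a d f u ^ 2
      ≤ ∑ u, f u ^ 2 - (∑ u, ∑ v, a u v * (f u - f v) ^ 2) / (4 * d) := by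
  set D := ∑ u, ∑ v, a u v * (f u - f v) ^ 2 with hD
  have hcross : ∑ u, f u * ∑ v, a u v * (f u - f v) = D / 2 := by
    have h1 : ∑ u, f u * ∑ v, a u v * (f u - f v) = ∑ u, ∑ v, a u v * (f u * (f u - f v)) :=
      sum_congr rfl fun u _ => by
        rw [mul_sum]; exact sum_congr rfl fun v _ => by ring
    have h2 : ∑ u, ∑ v, a u v * (f u * (f u - f v)) = ∑ u, ∑ v, a u v * (f v * (f v - f u)) := by
      rw [sum_comm]
      exact sum_congr rfl fun u _ => sum_congr rfl fun v _ => by rw [ha]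
    have h3 : D = ∑ u, ∑ v, a u v * (f u * (f u - f v))
        + ∑ u, ∑ v, a u v * (f v * (f v - f u)) := by
      simp_rw [hD, ← sum_add_distrib]
      exact sum_congr rfl fun u _ => sum_congr rfl fun v _ => by ring
    linarith
  have hsq : ∑ u, (∑ v, a u v * (f u - f v)) ^ 2 ≤ d * D := by
    rw [hD, mul_sum]
    refine sum_le_sum fun u _ => ?_
    refine (sum_sq_le_sum_mul_sum_of_sq_le_mul univ (f := fun v => a u v)
      (g := fun v => a u v * (f u - f v) ^ 2) (fun v _ => ha0 u v)
      (fun v _ => mul_nonneg (ha0 _ _) (sq_nonneg _)) fun v _ => le_of_eq (by ring)).trans ?_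
    exact mul_le_mul_of_nonneg_right (hdeg u)
      (sum_nonneg fun v _ => mul_nonneg (ha0 _ _) (sq_nonneg _))
  have hexp : ∑ u, lazyStep a d f u ^ 2 = ∑ u, f u ^ 2
      - (∑ u, f u * ∑ v, a u v * (f u - f v)) / d
      + (∑ u, (∑ v, a u v * (f u - f v)) ^ 2) / (4 * d ^ 2) := by
    simp_rw [sum_div, ← sum_sub_distrib, ← sum_add_distrib]
    refine sum_congr rfl fun u _ => ?_
    rw [lazyStep]
    field_simp
    ring
  have h4 : (∑ u, (∑ v, a u v * (f u - f v)) ^ 2) / (4 * d ^ 2) ≤ D / (4 * d) := by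
    rw [div_le_div_iff₀ (by positivity) (by positivity)]
    nlinarith
  rw [hexp, hcross]
  have h5 : D / 2 / d = D / (4 * d) + D / (4 * d) := by field_simp; ring
  linarith

variable [DecidableEq V]

/-- A step of the walk contracts functions supported on `A` by an amount *linear* in the density of
the complement of `A`. This comes from the global Poincaré inequality, as such a function has
`(∑ f) ^ 2 ≤ #A * ∑ f ^ 2`; applying Cheeger's argument inside `A` would only give the square of
the density. -/
theorem sum_sq_lazyStep_le_of_support (a : V → V → ℝ) (ha : ∀ u v, a u v = a v u)
    (ha0 : ∀ u v, 0 ≤ a u v) {d ε : ℝ} (hd : 0 < d) (hdeg : ∀ u, ∑ v, a u v ≤ d) (hε : 0 ≤ ε)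
    (hcut : ∀ S : Finset V, (#S : ℝ) ≤ (Fintype.card V : ℝ) / 2 →
      ε * d * #S ≤ ∑ u ∈ S, ∑ v ∈ Sᶜ, a u v)
    (A : Finset V) (f : V → ℝ) (hf : ∀ v, v ∉ A → f v = 0) :
    ∑ u, lazyStep a d f u ^ 2
      ≤ (1 - ε ^ 2 * (1 - #A / Fintype.card V) / 4) * ∑ u, f u ^ 2 := by
  have h1 := sum_sq_lazyStep_le a ha ha0 hd hdeg f
  have h2 := poincare_of_cut a ha ha0 hd hdeg hε hcut f
  have h3 : (∑ v, f v) ^ 2 ≤ #A * ∑ v, f v ^ 2 := by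
    rw [← sum_subset (subset_univ A) fun v _ hv => hf v hv,
      ← sum_subset (s₁ := A) (f := fun v => f v ^ 2) (subset_univ A)
        fun v _ hv => by simp [hf v hv]]
    exact sq_sum_le_card_mul_sum_sq
  have h4 : (∑ v, f v) ^ 2 / Fintype.card V ≤ #A / Fintype.card V * ∑ v, f v ^ 2 := by
    rw [div_mul_eq_mul_div]
    gcongr
  have h5 : ε ^ 2 * (1 - #A / Fintype.card V) / 4 * ∑ u, f u ^ 2
      ≤ (∑ u, ∑ v, a u v * (f u - f v) ^ 2) / (4 * d) := by
    rw [le_div_iff₀ (by positivity)]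
    have h6 : ε ^ 2 * d * ((1 - #A / Fintype.card V) * ∑ u, f u ^ 2)
        ≤ ε ^ 2 * d * (∑ v, f v ^ 2 - (∑ v, f v) ^ 2 / Fintype.card V) :=
      mul_le_mul_of_nonneg_left (by linarith) (by positivity)
    linarith
  linarith

/-- The probability that the first `L + 1` positions of the lazy walk started at `v` all lie
in `A`. -/
noncomputable def stayProb (a : V → V → ℝ) (d : ℝ) (A : Finset V) : ℕ → V → ℝ
  | 0, v => if v ∈ A then 1 else 0
  | L + 1, v => if v ∈ A then lazyStep a d (stayProb a d A L) v else 0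

theorem stayProb_eq_zero (a : V → V → ℝ) (d : ℝ) (A : Finset V) (L : ℕ) {v : V} (hv : v ∉ A) :
    stayProb a d A L v = 0 := by
  cases L <;> simp [stayProb, hv]

theorem sum_sq_stayProb_le (a : V → V → ℝ) (ha : ∀ u v, a u v = a v u)
    (ha0 : ∀ u v, 0 ≤ a u v) {d ε : ℝ} (hd : 0 < d) (hdeg : ∀ u, ∑ v, a u v ≤ d) (hε : 0 ≤ ε)
    (hε1 : ε ≤ 1)
    (hcut : ∀ S : Finset V, (#S : ℝ) ≤ (Fintype.card V : ℝ) / 2 →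
      ε * d * #S ≤ ∑ u ∈ S, ∑ v ∈ Sᶜ, a u v)
    (A : Finset V) (L : ℕ) :
    ∑ v, stayProb a d A L v ^ 2 ≤ (1 - ε ^ 2 * (1 - #A / Fintype.card V) / 4) ^ L * #A := by
  have hnn : 0 ≤ 1 - ε ^ 2 * (1 - #A / Fintype.card V) / 4 := by
    have h1 : (0 : ℝ) ≤ #A / Fintype.card V := by positivity
    have h2 : ε ^ 2 ≤ 1 := pow_le_one₀ hε hε1
    nlinarith [mul_nonneg (sq_nonneg ε) h1]
  induction L with
  | zero => simp [stayProb]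
  | succ L ih =>
    rw [pow_succ', mul_assoc]
    refine le_trans ?_ (mul_le_mul_of_nonneg_left ih hnn)
    refine le_trans (sum_le_sum fun v _ => ?_) (sum_sq_lazyStep_le_of_support a ha ha0 hd hdeg hε
      hcut A (stayProb a d A L) fun v hv => stayProb_eq_zero a d A L hv)
    rw [stayProb]
    split_ifs
    · rfl
    · simpa using sq_nonneg (lazyStep a d (stayProb a d A L) v)

/-- From a uniformly random start, the lazy walk of length `L` misses a set of density `w` with
probability at most `(1 - w) * exp (-(ε ^ 2 * L / 8) * w)`; here `w` is the density
of `Aᶜ`, and both sides are multiplied by the number of vertices. -/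
theorem sum_stayProb_le (a : V → V → ℝ) (ha : ∀ u v, a u v = a v u)
    (ha0 : ∀ u v, 0 ≤ a u v) {d ε : ℝ} (hd : 0 < d) (hdeg : ∀ u, ∑ v, a u v ≤ d) (hε : 0 ≤ ε)
    (hε1 : ε ≤ 1)
    (hcut : ∀ S : Finset V, (#S : ℝ) ≤ (Fintype.card V : ℝ) / 2 →
      ε * d * #S ≤ ∑ u ∈ S, ∑ v ∈ Sᶜ, a u v)
    (A : Finset V) (L : ℕ) :
    ∑ v, stayProb a d A L v
      ≤ #A * Real.exp (-(ε ^ 2 * L / 8 * (1 - #A / Fintype.card V))) := by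
  have h1 := sum_sq_stayProb_le a ha ha0 hd hdeg hε hε1 hcut A L
  have h2 : (∑ v, stayProb a d A L v) ^ 2 ≤ #A * ∑ v, stayProb a d A L v ^ 2 := by
    rw [← sum_subset (subset_univ A) fun v _ hv => stayProb_eq_zero a d A L hv,
      ← sum_subset (s₁ := A) (f := fun v => stayProb a d A L v ^ 2) (subset_univ A)
        fun v _ hv => by simp [stayProb_eq_zero a d A L hv]]
    exact sq_sum_le_card_mul_sum_sq
  set x := ε ^ 2 * (1 - #A / Fintype.card V) / 4 with hx
  have hnn : 0 ≤ 1 - x := by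
    have h1 : (0 : ℝ) ≤ #A / Fintype.card V := by positivity
    have h2 : ε ^ 2 ≤ 1 := pow_le_one₀ hε hε1
    nlinarith [mul_nonneg (sq_nonneg ε) h1]
  have h3 : (1 - x) ^ L ≤ Real.exp (-(ε ^ 2 * L / 8 * (1 - #A / Fintype.card V))) ^ 2 := by
    refine (pow_le_pow_left₀ hnn (Real.one_sub_le_exp_neg x) L).trans (le_of_eq ?_)
    rw [← Real.exp_nat_mul, ← Real.exp_nat_mul, hx]
    congr 1
    push_cast
    ring
  refine le_of_sq_le_sq ?_ (by positivity)
  calc _ ≤ _ := h2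
    _ ≤ #A * ((1 - x) ^ L * #A) := by gcongr
    _ ≤ #A * (Real.exp (-(ε ^ 2 * L / 8 * (1 - #A / Fintype.card V))) ^ 2 * #A) := by gcongr
    _ = _ := by ring

/-! ### Connected vertex sets of walks -/

theorem SimpleGraph.connected_induce_insert {W : Type*} [DecidableEq W]
    {G : SimpleGraph W} {T : Finset W}
    (hT : (G.induce (T : Set W)).Connected) {u v : W} (hv : v ∈ T) (h : u = v ∨ G.Adj u v) :
    (G.induce ((insert u T : Finset W) : Set W)).Connected := by
  rcases h with rfl | h
  · rwa [insert_eq_of_mem hv]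
  · have := connected_induce_union (G := G) (s := (T : Set W)) (t := {u}) hT.preconnected
      (Preconnected.of_subsingleton) (v := v) (w := u) (by simpa using hv) rfl h.symm
    rwa [coe_insert, Set.insert_eq, Set.union_comm]

/-- The vertices of a lazy walk form a connected set. Choosing the steps by conditional expectations
yields a walk from `v` whose vertex set lies in no more of the sets `A j` than the walk does on
average. -/
theorem exists_connected_sum_le_sum_stayProb {ι : Type*} (G : SimpleGraph V) [DecidableRel G.Adj]
    {d : ℝ} (hd : 0 < d) (hdeg : ∀ u, ∑ v, G.adjWeight u v ≤ d) (A : ι → Finset V) (L : ℕ)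
    (J : Finset ι) (v : V) :
    ∃ T : Finset V, v ∈ T ∧ (G.induce (T : Set V)).Connected ∧ #T ≤ L + 1 ∧
      (#{j ∈ J | T ⊆ A j} : ℝ) ≤ ∑ j ∈ J, stayProb G.adjWeight d (A j) L v := by
  induction L generalizing J v with
  | zero =>
    refine ⟨{v}, by simp, ?_, by simp, ?_⟩
    · rw [coe_singleton]
      exact { preconnected := .of_subsingleton }
    · simp [stayProb]
  | succ L ih =>
    -- Only the sets containing `v` can contain the walk.
    obtain ⟨u, hu, hle⟩ := exists_le_lazyStep G.adjWeight G.adjWeight_nonneg hd hdeg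
      (fun w => ∑ j ∈ J with v ∈ A j, stayProb G.adjWeight d (A j) L w) v
    obtain ⟨T, huT, hT, hcard, hsum⟩ := ih {j ∈ J | v ∈ A j} u
    have hadj : v = u ∨ G.Adj v u := by
      rcases hu with rfl | hu
      · exact Or.inl rfl
      · right
        by_contra h
        simp [SimpleGraph.adjWeight, h] at hu
    refine ⟨insert v T, mem_insert_self _ _, SimpleGraph.connected_induce_insert hT huT hadj,
      (card_insert_le _ _).trans (by omega), ?_⟩
    have h1 : ({j ∈ J | insert v T ⊆ A j} : Finset ι) = {j ∈ {j ∈ J | v ∈ A j} | T ⊆ A j} := by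
      ext j; simp [insert_subset_iff, and_assoc]
    rw [lazyStep_sum] at hle
    rw [h1]
    refine hsum.trans (hle.trans (le_of_eq ?_))
    simp [stayProb, sum_filter]

end LazyWalk

/-! ### Growth of neighbourhoods -/

namespace SimpleGraph

variable {V : Type*} [Fintype V] [DecidableEq V] (G : SimpleGraph V) [DecidableRel G.Adj]

theorem le_sum_adjWeight_of_le_cheegerConstant {c : ℝ} (h : c ≤ G.cheegerConstant)
    (S : Finset V) (hS : (#S : ℝ) ≤ (Fintype.card V : ℝ) / 2) :
    c * #S ≤ ∑ u ∈ S, ∑ v ∈ Sᶜ, G.adjWeight u v := by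
  rcases S.eq_empty_or_nonempty with rfl | hne
  · simp
  have h1 : G.cheegerConstant ≤ G.edgeExpansion S :=
    csInf_le (Set.toFinite _).bddBelow ⟨S, ⟨hne, hS⟩, rfl⟩
  have hpos : (0 : ℝ) < #S := by exact_mod_cast hne.card_pos
  rw [sum_adjWeight_eq_card_interedges, ← le_div_iff₀ hpos]
  exact h.trans h1

/-- The set of vertices at distance at most `r` from `U`. -/
def neighborhoodIter (U : Finset V) : ℕ → Finset V
  | 0 => U
  | r + 1 => neighborhoodIter U r ∪ univ.filter fun v => ∃ u ∈ neighborhoodIter U r, G.Adj u v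

theorem neighborhoodIter_subset_succ (U : Finset V) (r : ℕ) :
    G.neighborhoodIter U r ⊆ G.neighborhoodIter U (r + 1) :=
  subset_union_left

variable {G}

/-- All edges between `B = neighborhoodIter U r` and its complement end in the next layer, whose
vertices each take at most `d` of them. Expansion is applied to the smaller of `B` and `Bᶜ`. -/
theorem min_card_le_card_neighborhoodIter_sub {d ε : ℝ} (hd : 0 < d)
    (hdeg : ∀ u, ∑ v, G.adjWeight u v ≤ d)
    (hcut : ∀ S : Finset V, (#S : ℝ) ≤ (Fintype.card V : ℝ) / 2 →
      ε * d * #S ≤ ∑ u ∈ S, ∑ v ∈ Sᶜ, G.adjWeight u v) (U : Finset V) (r : ℕ) :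
    ε * min (#(G.neighborhoodIter U r) : ℝ) (Fintype.card V - #(G.neighborhoodIter U r))
      ≤ #(G.neighborhoodIter U (r + 1)) - #(G.neighborhoodIter U r) := by
  set B := G.neighborhoodIter U r with hB
  set B' := G.neighborhoodIter U (r + 1) with hB'
  have hsub : B ⊆ B' := G.neighborhoodIter_subset_succ U r
  have hcompl : (#Bᶜ : ℝ) = Fintype.card V - #B := by
    rw [card_compl, Nat.cast_sub (card_le_univ _)]
  have hout : ∑ v ∈ Bᶜ, ∑ u ∈ B, G.adjWeight v u ≤ d * (#B' - #B) := by
    have h1 : ∑ v ∈ Bᶜ, ∑ u ∈ B, G.adjWeight v u ≤ ∑ v ∈ Bᶜ, if v ∈ B' then d else 0 := by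
      refine sum_le_sum fun v hv => ?_
      split_ifs with h
      · exact (sum_le_sum_of_subset_of_nonneg (subset_univ _)
          fun u _ _ => G.adjWeight_nonneg v u).trans (hdeg v)
      · refine le_of_eq (sum_eq_zero fun u hu => ?_)
        rw [adjWeight, if_neg]
        intro hadj
        exact h (mem_union_right _ (by simpa using ⟨u, hu, hadj.symm⟩))
    refine h1.trans (le_of_eq ?_)
    rw [← sum_filter, sum_const, nsmul_eq_mul, mul_comm]
    congr 1
    have h2 : ({v ∈ Bᶜ | v ∈ B'} : Finset V) = B' \ B := by
      ext v; simp [and_comm]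
    rw [h2, card_sdiff_of_subset hsub, Nat.cast_sub (card_le_card hsub)]
  have hin : ∑ u ∈ B, ∑ v ∈ Bᶜ, G.adjWeight u v ≤ d * (#B' - #B) := by
    rw [sum_comm]
    simpa only [G.adjWeight_comm] using hout
  refine le_of_mul_le_mul_left ?_ hd
  rcases le_total (#B : ℝ) (Fintype.card V / 2) with h | h
  · have := hcut B h
    rw [min_eq_left (by linarith)]
    linarith
  · have := hcut Bᶜ (by linarith)
    rw [compl_compl, hcompl] at this
    rw [min_eq_right (by linarith)]
    linarith

/-- Positive expansion makes every neighbourhood gain a vertex until it is everything. -/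
theorem neighborhoodIter_card_eq_univ {d ε : ℝ} (hd : 0 < d) (hε : 0 < ε)
    (hdeg : ∀ u, ∑ v, G.adjWeight u v ≤ d)
    (hcut : ∀ S : Finset V, (#S : ℝ) ≤ (Fintype.card V : ℝ) / 2 →
      ε * d * #S ≤ ∑ u ∈ S, ∑ v ∈ Sᶜ, G.adjWeight u v) {U : Finset V} (hU : U.Nonempty) :
    G.neighborhoodIter U (Fintype.card V) = univ := by
  have key : ∀ r, min (r + 1) (Fintype.card V) ≤ #(G.neighborhoodIter U r) := fun r => by
    induction r with
    | zero => exact (min_le_left _ _).trans hU.card_pos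
    | succ r ih =>
      have hle := card_le_card (G.neighborhoodIter_subset_succ U r)
      have hgrow := min_card_le_card_neighborhoodIter_sub hd hdeg hcut U r
      by_contra! hlt
      have h1 : #(G.neighborhoodIter U r) < Fintype.card V := by omega
      have h2 : #(G.neighborhoodIter U (r + 1)) = #(G.neighborhoodIter U r) := by omega
      have h3 : 0 < #(G.neighborhoodIter U r) := by omega
      have h4 : (0 : ℝ) < min (#(G.neighborhoodIter U r) : ℝ)
          (Fintype.card V - #(G.neighborhoodIter U r)) :=
        lt_min (by exact_mod_cast h3) (sub_pos.2 (by exact_mod_cast h1))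
      rw [h2, sub_self] at hgrow
      exact absurd (mul_pos hε h4) (not_lt.2 hgrow)
  rw [← card_eq_iff_eq_univ]
  have := key (Fintype.card V)
  have := card_le_univ (G.neighborhoodIter U (Fintype.card V))
  omega

/-! ### Linking a connected set to given sets -/

/-- The number of radii at which `T` misses the neighbourhood of `U` is the distance from `T` to `U`,
and a path of that length links `T` to `U`. -/
theorem exists_connected_superset_inter_nonempty (U : Finset V) (R : ℕ) (T : Finset V)
    (hT : (G.induce (T : Set V)).Connected) (h : (T ∩ G.neighborhoodIter U R).Nonempty) :
    ∃ T' : Finset V, T ⊆ T' ∧ (G.induce (T' : Set V)).Connected ∧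
      #T' ≤ #T + #{r ∈ range R | T ⊆ (G.neighborhoodIter U r)ᶜ} ∧ (T' ∩ U).Nonempty := by
  induction R generalizing T with
  | zero => exact ⟨T, Subset.rfl, hT, Nat.le_add_right _ _, h⟩
  | succ R ih =>
    by_cases hR : (T ∩ G.neighborhoodIter U R).Nonempty
    · obtain ⟨T', h1, h2, h3, h4⟩ := ih T hT hR
      refine ⟨T', h1, h2, h3.trans ?_, h4⟩
      gcongr
      exact Nat.le_succ R
    · obtain ⟨x, hx⟩ := h
      rw [mem_inter, neighborhoodIter, mem_union] at hx
      obtain ⟨hxT, hx | hx⟩ := hx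
      · exact absurd ⟨x, mem_inter.2 ⟨hxT, hx⟩⟩ hR
      obtain ⟨u, hu, hadj⟩ : ∃ u ∈ G.neighborhoodIter U R, G.Adj u x := by simpa using hx
      obtain ⟨T', h1, h2, h3, h4⟩ := ih (insert u T)
        (connected_induce_insert hT hxT (Or.inr hadj)) ⟨u, by simp [hu]⟩
      refine ⟨T', (subset_insert _ _).trans h1, h2, h3.trans ?_, h4⟩
      have hmiss : T ⊆ (G.neighborhoodIter U R)ᶜ := fun y hy =>
        mem_compl.2 fun hyR => hR ⟨y, mem_inter.2 ⟨hy, hyR⟩⟩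
      have hins := card_insert_le u T
      have hle : #{r ∈ range R | insert u T ⊆ (G.neighborhoodIter U r)ᶜ}
          ≤ #{r ∈ range R | T ⊆ (G.neighborhoodIter U r)ᶜ} :=
        card_le_card (monotone_filter_right _ fun r _ hr => (subset_insert _ _).trans hr)
      rw [range_add_one, filter_insert, if_pos hmiss,
        card_insert_of_notMem fun h => notMem_range_self (mem_filter.1 h).1]
      omega

theorem exists_connected_superset_forall_inter_nonempty {ι : Type*} (U : ι → Finset V) (R : ℕ)
    (hR : ∀ i, G.neighborhoodIter (U i) R = univ) (I : Finset ι) (T : Finset V)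
    (hT : (G.induce (T : Set V)).Connected) (hne : T.Nonempty) :
    ∃ T' : Finset V, T ⊆ T' ∧ (G.induce (T' : Set V)).Connected ∧
      #T' ≤ #T + ∑ i ∈ I, #{r ∈ range R | T ⊆ (G.neighborhoodIter (U i) r)ᶜ} ∧
      ∀ i ∈ I, (T' ∩ U i).Nonempty := by
  classical
  induction I using Finset.induction_on with
  | empty => exact ⟨T, Subset.rfl, hT, by simp, by simp⟩
  | insert i I hi ih =>
    obtain ⟨T₁, h1, h2, h3, h4⟩ := ih
    obtain ⟨T₂, k1, k2, k3, k4⟩ := exists_connected_superset_inter_nonempty (U i) R T₁ h2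
      (by rw [hR, inter_univ]; exact hne.mono h1)
    refine ⟨T₂, h1.trans k1, k2, k3.trans ?_, ?_⟩
    · have hle : #{r ∈ range R | T₁ ⊆ (G.neighborhoodIter (U i) r)ᶜ}
          ≤ #{r ∈ range R | T ⊆ (G.neighborhoodIter (U i) r)ᶜ} :=
        card_le_card (monotone_filter_right _ fun r _ hr => h1.trans hr)
      rw [sum_insert hi]
      omega
    · intro j hj
      rcases mem_insert.1 hj with rfl | hj
      · exact k4
      · exact (h4 j hj).mono (inter_subset_inter_right k1)

end SimpleGraph

/-! ### A connected set meeting many large sets -/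

/-- The densities `w r` of the growing neighbourhoods of a set give a bounded sum of the
probabilities `(1 - w r) * exp (-κ * w r)` of being missed: up to density `1 / 2` the exponential
decays geometrically, from then on the factor `1 - w r` does. Both regimes are covered by the
potential `(1 - w) * exp (-κ * w 0) + 3 * exp (-κ * w)`, which drops in every step by at least `ε`
times the summand. -/
theorem sum_one_sub_mul_exp_le {ε κ : ℝ} (hε : 0 < ε) (hε1 : ε ≤ 1) (hκ : 0 ≤ κ) (w : ℕ → ℝ)
    (hw1 : ∀ r, w r ≤ 1) (hw0 : 0 ≤ w 0)
    (hstep : ∀ r, w r + ε * min (w r) (1 - w r) ≤ w (r + 1)) (hκw : 1 / 2 ≤ κ * w 0) (R : ℕ) :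
    ∑ r ∈ range R, (1 - w r) * Real.exp (-(κ * w r)) ≤ 4 / ε * Real.exp (-(κ * w 0)) := by
  have hmono : ∀ r, w 0 ≤ w r := fun r => by
    induction r with
    | zero => exact le_rfl
    | succ r ih =>
      have : 0 ≤ min (w r) (1 - w r) := le_min (hw0.trans ih) (by linarith [hw1 r])
      nlinarith [hstep r, mul_nonneg hε.le this]
  set E := Real.exp (-(κ * w 0)) with hE
  have hE0 : 0 < E := Real.exp_pos _
  have key : ε * ∑ r ∈ range R, (1 - w r) * Real.exp (-(κ * w r))
      ≤ ((1 - w 0) * E + 3 * E) - ((1 - w R) * E + 3 * Real.exp (-(κ * w R))) := by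
    induction R with
    | zero => simp [hE]
    | succ r ih =>
      rw [sum_range_succ, mul_add]
      set e := Real.exp (-(κ * w r)) with he
      set e' := Real.exp (-(κ * w (r + 1))) with he'
      have he0 : 0 < e := Real.exp_pos _
      have heE : e ≤ E := Real.exp_le_exp.2 (by nlinarith [hmono r])
      have hr1 := hw1 r
      have hr0 : 0 ≤ w r := hw0.trans (hmono r)
      have hs := hstep r
      suffices ε * ((1 - w r) * e) ≤ (w (r + 1) - w r) * E + 3 * (e - e') by linarith
      rcases le_total (w r) (1 / 2) with h | h
      · rw [min_eq_left (by linarith)] at hs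
        have h1 : e' ≤ e * Real.exp (-(ε / 2)) := by
          rw [he, he', ← Real.exp_add]
          refine Real.exp_le_exp.2 ?_
          have h2 : κ * (w r + ε * w r) ≤ κ * w (r + 1) := mul_le_mul_of_nonneg_left hs hκ
          have h3 : 1 / 2 ≤ κ * w r := hκw.trans (mul_le_mul_of_nonneg_left (hmono r) hκ)
          nlinarith
        -- `(1 - ε / 3) * (1 + ε / 2) ≥ 1` as `ε ≤ 1`.
        have h4 : Real.exp (-(ε / 2)) ≤ 1 - ε / 3 := by
          have h5 := Real.add_one_le_exp (ε / 2)
          rw [Real.exp_neg]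
          refine inv_le_of_inv_le₀ (by linarith) (le_trans ?_ h5)
          rw [inv_le_iff_one_le_mul₀ (by linarith)]
          nlinarith
        have h6 : e' ≤ e * (1 - ε / 3) := h1.trans (mul_le_mul_of_nonneg_left h4 he0.le)
        have h7 : 0 ≤ (w (r + 1) - w r) * E :=
          mul_nonneg (by nlinarith) hE0.le
        nlinarith [mul_nonneg (mul_nonneg hε.le he0.le) hr0]
      · rw [min_eq_right (by linarith)] at hs
        have h1 : e' ≤ e := Real.exp_le_exp.2 (by
          have : w r ≤ w (r + 1) := by nlinarith
          nlinarith)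
        have h2 : ε * (1 - w r) * e ≤ (w (r + 1) - w r) * E :=
          mul_le_mul (by linarith) heE he0.le (by nlinarith)
        linarith
  have hlast : 0 ≤ (1 - w R) * E + 3 * Real.exp (-(κ * w R)) :=
    add_nonneg (mul_nonneg (by linarith [hw1 R]) hE0.le) (by positivity)
  rw [div_mul_eq_mul_div, le_div_iff₀ hε]
  nlinarith [mul_nonneg hw0 hE0.le]

/-- The walk of length `L` has expected distance at most `4 / ε * exp (-(ε ^ 2 * L / 8) * (s / n))` to
each `U i`; adding paths to the vertex set of a walk attaining the average of the sum of these
distances hits every `U i`. -/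
theorem exists_connected_inter_nonempty_card_le {V : Type*} [Fintype V] [DecidableEq V]
    [Nonempty V] {ι : Type*} [Fintype ι] {G : SimpleGraph V} [DecidableRel G.Adj]
    {d ε s : ℝ} (hd : 0 < d) (hε : 0 < ε) (hε1 : ε ≤ 1)
    (hdeg : ∀ u, ∑ v, G.adjWeight u v ≤ d)
    (hcut : ∀ S : Finset V, (#S : ℝ) ≤ (Fintype.card V : ℝ) / 2 →
      ε * d * #S ≤ ∑ u ∈ S, ∑ v ∈ Sᶜ, G.adjWeight u v)
    (hs : 0 < s) (U : ι → Finset V) (hU : ∀ i, s ≤ #(U i)) (L : ℕ)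
    (hL : 1 / 2 ≤ ε ^ 2 * L / 8 * (s / Fintype.card V)) :
    ∃ T : Finset V, (G.induce (T : Set V)).Connected ∧ (∀ i, (T ∩ U i).Nonempty) ∧
      (#T : ℝ) ≤ L + 1 + Fintype.card ι *
        (4 / ε * Real.exp (-(ε ^ 2 * L / 8 * (s / Fintype.card V)))) := by
  set n := Fintype.card V with hn
  set κ := ε ^ 2 * L / 8 with hκdef
  have hκ : 0 ≤ κ := by positivity
  have hn0 : (0 : ℝ) < n := by exact_mod_cast Fintype.card_pos
  have hUne : ∀ i, (U i).Nonempty := fun i => by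
    rw [← card_pos]
    exact_mod_cast hs.trans_le (hU i)
  -- `T ⊆ A (i, r)` says that `T` has distance more than `r` from `U i`.
  set A : ι × ℕ → Finset V := fun j => (G.neighborhoodIter (U j.1) j.2)ᶜ with hA
  set J : Finset (ι × ℕ) := univ ×ˢ range n with hJ
  have hw : ∀ i, ∑ r ∈ range n, ∑ v, stayProb G.adjWeight d (A (i, r)) L v
      ≤ n * (4 / ε * Real.exp (-(κ * (s / n)))) := fun i => by
    set w : ℕ → ℝ := fun r => #(G.neighborhoodIter (U i) r) / n with hwdef
    have hAw : ∀ r, (#(A (i, r)) : ℝ) = n * (1 - w r) := fun r => by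
      simp only [hA, hwdef]
      rw [card_compl, Nat.cast_sub (card_le_univ _)]
      field_simp
      rfl
    have hsw : s / n ≤ w 0 := by
      simp only [hwdef]
      gcongr
      exact hU i
    have hsum := sum_one_sub_mul_exp_le hε hε1 hκ w
      (fun r => by
        simp only [hwdef]
        rw [div_le_one hn0]
        exact_mod_cast card_le_univ _)
      (by positivity)
      (fun r => by
        have h := SimpleGraph.min_card_le_card_neighborhoodIter_sub hd hdeg hcut (U i) r
        have h1 : min (w r) (1 - w r) = min (#(G.neighborhoodIter (U i) r) : ℝ)
            (n - #(G.neighborhoodIter (U i) r)) / n := by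
          rw [← min_div_div_right hn0.le, sub_div, div_self hn0.ne']
        rw [h1]
        simp only [hwdef]
        rw [mul_div_assoc', ← add_div]
        gcongr
        linarith)
      (hL.trans (mul_le_mul_of_nonneg_left hsw hκ)) n
    calc ∑ r ∈ range n, ∑ v, stayProb G.adjWeight d (A (i, r)) L v
        ≤ ∑ r ∈ range n, n * ((1 - w r) * Real.exp (-(κ * w r))) := by
          refine sum_le_sum fun r _ => ?_
          refine (sum_stayProb_le G.adjWeight G.adjWeight_comm G.adjWeight_nonneg hd hdeg hε.le hε1
            hcut (A (i, r)) L).trans (le_of_eq ?_)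
          rw [hAw r, ← hn, mul_div_cancel_left₀ _ hn0.ne', sub_sub_cancel, mul_assoc]
      _ ≤ n * (4 / ε * Real.exp (-(κ * w 0))) := by
          rw [← mul_sum]
          gcongr
      _ ≤ n * (4 / ε * Real.exp (-(κ * (s / n)))) := by gcongr
  have havg : ∑ v, ∑ j ∈ J, stayProb G.adjWeight d (A j) L v
      ≤ ∑ _v : V, Fintype.card ι * (4 / ε * Real.exp (-(κ * (s / n)))) := by
    rw [sum_comm, hJ, sum_product]
    refine (sum_le_sum fun i _ => hw i).trans (le_of_eq ?_)
    simp only [sum_const, card_univ, nsmul_eq_mul, ← hn]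
    ring
  obtain ⟨v, -, hv⟩ := exists_le_of_sum_le univ_nonempty havg
  obtain ⟨T, hvT, hT, hTcard, hTsum⟩ :=
    exists_connected_sum_le_sum_stayProb G hd hdeg A L J v
  obtain ⟨T', -, hT', hcard, hmeet⟩ := SimpleGraph.exists_connected_superset_forall_inter_nonempty
    U n (fun i => SimpleGraph.neighborhoodIter_card_eq_univ hd hε hdeg hcut (hUne i)) univ T hT
    ⟨v, hvT⟩
  refine ⟨T', hT', fun i => hmeet i (mem_univ i), ?_⟩
  have hcount : #{j ∈ J | T ⊆ A j}
      = ∑ i, #{r ∈ range n | T ⊆ (G.neighborhoodIter (U i) r)ᶜ} := by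
    simp_rw [card_filter]
    rw [hJ, sum_product]
  rw [← hcount] at hcard
  have h1 : (#T' : ℝ) ≤ #T + #{j ∈ J | T ⊆ A j} := by exact_mod_cast hcard
  have h2 : (#T : ℝ) ≤ L + 1 := by exact_mod_cast hTcard
  linarith

theorem mainTheorem2 :
    ∃ C : ℝ, 0 < C ∧ ∀ ε : ℝ, 0 < ε → ε < 1 / 2 →
      ∃ K : ℝ, 0 < K ∧ K ≤ C / ε ^ 3 ∧ ∃ n₀ : ℕ,
        ∀ (V : Type*) [Fintype V] [DecidableEq V] (G : SimpleGraph V) [DecidableRel G.Adj]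
          (n : ℕ) (d : ℝ),
          Fintype.card V = n → n₀ ≤ n → 0 < d → (G.maxDegree : ℝ) ≤ d →
          ε * d ≤ G.cheegerConstant →
          ∀ (s : ℝ) (q : ℕ) (U : Fin q → Finset V),
            q ≤ n → 2 * (n : ℝ) ≤ s * q → (∀ i, s ≤ (#(U i) : ℝ)) →
            ∃ T : Finset V, (G.induce (T : Set V)).Connected ∧
              (#T : ℝ) ≤ K * ((n : ℝ) / s) * Real.log ((q : ℝ) * s / n) ∧
              ∀ i, (T ∩ U i).Nonempty := by
  refine ⟨20, by norm_num, fun ε hε hε2 => ⟨20 / ε ^ 2, by positivity, ?_, 1, ?_⟩⟩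
  · exact div_le_div_of_nonneg_left (by norm_num) (by positivity)
      (pow_le_pow_of_le_one hε.le (by linarith) (by norm_num))
  intro V _ _ G _ n d hn hn1 hd hmax hch s q U _ hsq hU
  subst hn
  set n := Fintype.card V with hn
  have : Nonempty V := Fintype.card_pos_iff.1 hn1
  have hn0 : (0 : ℝ) < n := by exact_mod_cast hn1
  have hsq0 : 0 < s * q := by linarith
  have hs : 0 < s := pos_of_mul_pos_left hsq0 q.cast_nonneg
  have hq : (0 : ℝ) < q := pos_of_mul_pos_right hsq0 hs.le
  have hsn : s ≤ n := (hU ⟨0, by exact_mod_cast hq⟩).trans (by exact_mod_cast card_le_univ _)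
  have hratio : 2 ≤ (q : ℝ) * s / n := by
    rw [le_div_iff₀ hn0]; linarith
  set ℓ := Real.log ((q : ℝ) * s / n) with hℓ
  have hℓ2 : 1 / 2 ≤ ℓ := by
    have := Real.log_le_log (by norm_num) hratio
    linarith [Real.log_two_gt_d9]
  set X := (n : ℝ) / s * ℓ with hX
  have hns : 1 ≤ (n : ℝ) / s := (one_le_div hs).2 hsn
  have hX2 : (n : ℝ) / s ≤ 2 * X := by nlinarith
  -- This length makes the walk miss a set of density `s / n` with probability at most `n / (q * s)`.
  set L := ⌈8 * X / ε ^ 2⌉₊ with hLdef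
  have hLlow : 8 * X / ε ^ 2 ≤ L := Nat.le_ceil _
  have hLup : (L : ℝ) < 8 * X / ε ^ 2 + 1 := Nat.ceil_lt_add_one (by
    have : 0 ≤ X := by linarith
    positivity)
  have hκ : ℓ ≤ ε ^ 2 * L / 8 * (s / n) := by
    rw [div_le_iff₀ (by positivity)] at hLlow
    have h1 : X ≤ ε ^ 2 * L / 8 := by linarith
    refine le_trans (le_of_eq ?_) (mul_le_mul_of_nonneg_right h1 (by positivity))
    rw [hX]
    field_simp
  obtain ⟨T, hT, hmeet, hcard⟩ := exists_connected_inter_nonempty_card_le hd hε (by linarith)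
    (fun u => (G.sum_adjWeight u).trans_le (le_trans (by exact_mod_cast G.degree_le_maxDegree u)
      hmax))
    (G.le_sum_adjWeight_of_le_cheegerConstant hch) hs U hU L (hℓ2.trans hκ)
  refine ⟨T, hT, hcard.trans ?_, hmeet⟩
  have hexp : Real.exp (-(ε ^ 2 * L / 8 * (s / n))) ≤ n / (q * s) := by
    refine (Real.exp_le_exp.2 (neg_le_neg hκ)).trans (le_of_eq ?_)
    rw [Real.exp_neg, hℓ, Real.exp_log (by linarith), inv_div]
  have htail : (Fintype.card (Fin q) : ℝ) * (4 / ε * Real.exp (-(ε ^ 2 * L / 8 * (s / n))))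
      ≤ 4 / ε * (n / s) := by
    rw [Fintype.card_fin]
    calc (q : ℝ) * (4 / ε * Real.exp (-(ε ^ 2 * L / 8 * (s / n))))
        ≤ q * (4 / ε * (n / (q * s))) := by gcongr
      _ = 4 / ε * (n / s) := by field_simp
  have hX0 : 0 ≤ X := by linarith
  have h1 : 4 / ε * ((n : ℝ) / s) ≤ 8 * X / ε ^ 2 := by
    rw [div_mul_eq_mul_div, div_le_div_iff₀ hε (by positivity)]
    nlinarith [mul_le_mul_of_nonneg_left hX2 hε.le, mul_nonneg hε.le hX0,
      mul_nonneg (mul_nonneg hε.le hε.le) hX0, mul_le_mul_of_nonneg_left hX2 (sq_nonneg ε),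
      mul_nonneg hX0 (mul_nonneg hε.le (by linarith : 0 ≤ 1 - ε))]
  have h2 : 2 ≤ 4 * X / ε ^ 2 := by
    rw [le_div_iff₀ (by positivity)]
    nlinarith
  have h3 : 20 / ε ^ 2 * (n / s) * ℓ = 8 * X / ε ^ 2 + 4 * X / ε ^ 2 + 8 * X / ε ^ 2 := by
    rw [hX]; ring
  rw [h3]
  linarith
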